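/- Let $n\ge 1$, let $(x_1,\dots,x_n,z)$ be coordinates on $\mathbb{C}^{n+1}$ and $S=\mathbb{C}[x_1,\dots,x_n,z]$. Let $\mathrm{Cat}_n$ be the (cone of the) Catalan arrangement of type $A$, i.e. the set of hyperplanes in $\mathbb{C}^{n+1}$ defined by $$z\cdot\prod_{1\le i<j\le n}(x_i-x_j)(x_i-x_j-z)(x_i-x_j+z)=0 .$$ For a hyperplane $H$ let $\alpha_H$ be a defining linear form, and let $$D(\mathrm{Cat}_n)=\{\delta\in\mathrm{Der}_{\mathbb{C}}(S)\mid \delta\alpha_H\in(\alpha_H)\ \text{for all } H\in\mathrm{Cat}_n\}$$ be the $S$-module of logarithmic derivations. Then $\mathrm{Cat}_n$ is free with exponents $(0,1,n+1,n+2,\dots,2n-1)$; that is, $D(\mathrm{Cat}_n)$ is a free $S$-module having a basis $\delta_1,\dots,\delta_{n+1}$ of homogeneous derivations whose polynomial degrees are, in order, $0,1,n+1,n+2,\dots,2n-1$. Here $\delta$ is homogeneous of polynomial degree $d$ if $\delta x_1,\dots,\delta x_n,\delta z$ are all homogeneous polynomials of degree $d$ (the zero polynomial being homogeneous of every degree).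 For $n=1$ the exponents are $(0,1)$. -/

import Mathlib

/-- A (central) arrangement of hyperplanes in the coordinate space `ℂ^σ`: a finite set of linear
hyperplanes, i.e. of maximal proper linear subspaces. -/
structure HyperplaneArrangement (σ : Type*) where
  hyperplanes : Set (Submodule ℂ (σ → ℂ))
  finite : hyperplanes.Finite
  isCoatom : ∀ H ∈ hyperplanes, IsCoatom H

namespace HyperplaneArrangement

/-- The arrangement of the kernels of a finite set of nonzero linear forms. -/
def ofForms {σ : Type*} (Φ : Set (Module.Dual ℂ (σ → ℂ))) (hfin : Φ.Finite)
    (hne : ∀ α ∈ Φ, α ≠ 0) : HyperplaneArrangement σ where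
  hyperplanes := (fun α : Module.Dual ℂ (σ → ℂ) => LinearMap.ker α) '' Φ
  finite := hfin.image _
  isCoatom := by
    rintro _ ⟨α, hα, rfl⟩
    exact LinearMap.isCoatom_ker_of_surjective (LinearMap.surjective (hne α hα))

/-- The linear form `α` on `ℂ^σ` as a polynomial in the coordinates: `∑ α(e_i) x_i`. -/
noncomputable def formPoly {σ : Type*} [Fintype σ] [DecidableEq σ]
    (α : Module.Dual ℂ (σ → ℂ)) : MvPolynomial σ ℂ :=
  ∑ i, MvPolynomial.C (α (Pi.single i 1)) * MvPolynomial.X i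

/-- The module `D(A, m)` of logarithmic vector fields of the multiarrangement `(A, m)`: the
`S`-derivations `δ` such that `δ α_H ∈ (α_H)^{m(H)}` for every `H` in `A`, where `α_H` is a
defining linear form of `H` (forms defining the same `H` are proportional, so it makes no
difference that all of them are tested). -/
noncomputable def logDerivations {σ : Type*} [Fintype σ] [DecidableEq σ]
    (A : HyperplaneArrangement σ) (m : A.hyperplanes → ℕ) :
    Submodule (MvPolynomial σ ℂ)
      (Derivation ℂ (MvPolynomial σ ℂ) (MvPolynomial σ ℂ)) where
  carrier := {δ | ∀ (H : A.hyperplanes) (α : Module.Dual ℂ (σ → ℂ)),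
    LinearMap.ker α = (H : Submodule ℂ (σ → ℂ)) →
      δ (formPoly α) ∈ Ideal.span {formPoly α} ^ m H}
  zero_mem' := by
    intro H α _
    simp
  add_mem' := by
    intro δ ε hδ hε H α h
    rw [Derivation.add_apply]
    exact Ideal.add_mem _ (hδ H α h) (hε H α h)
  smul_mem' := by
    intro f δ hδ H α h
    rw [Derivation.smul_apply, smul_eq_mul]
    exact Ideal.mul_mem_left _ f (hδ H α h)

/-- The derivation `δ = ∑ f_i ∂_i` is homogeneous of polynomial degree `d`: each coefficient
`f_i = δ x_i` is homogeneous of degree `d`. -/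
def IsHomogeneousDerivation {σ : Type*}
    (δ : Derivation ℂ (MvPolynomial σ ℂ) (MvPolynomial σ ℂ)) (d : ℕ) : Prop :=
  ∀ i, (δ (MvPolynomial.X i)).IsHomogeneous d

/-- The multiarrangement `(A, m)` is free with exponents `e = (e_1, …, e_ℓ)`: `D(A, m)` has an
`S`-basis `δ_1, …, δ_ℓ` with `δ_i` homogeneous of degree `e_i`. -/
def IsMultiFreeWithExponents {σ : Type*} [Fintype σ] [DecidableEq σ]
    (A : HyperplaneArrangement σ) (m : A.hyperplanes → ℕ) (e : List ℕ) : Prop :=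
  ∃ b : Module.Basis (Fin e.length) (MvPolynomial σ ℂ) (A.logDerivations m),
    ∀ i, IsHomogeneousDerivation
      (b i : Derivation ℂ (MvPolynomial σ ℂ) (MvPolynomial σ ℂ)) (e.get i)

/-- The (simple) arrangement `A` is free with exponents `e`: so is `(A, 1)`. -/
def IsFreeWithExponents {σ : Type*} [Fintype σ] [DecidableEq σ]
    (A : HyperplaneArrangement σ) (e : List ℕ) : Prop :=
  A.IsMultiFreeWithExponents (fun _ => 1) e

end HyperplaneArrangement

namespace CatalanArrangement

/-- The coordinate `x_i` on `ℂ^{n+1}`; coordinates are indexed by `Option (Fin n)`. -/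
def x {n : ℕ} (i : Fin n) : Module.Dual ℂ (Option (Fin n) → ℂ) := LinearMap.proj (some i)

/-- The last coordinate `z` on `ℂ^{n+1}`. -/
def z {n : ℕ} : Module.Dual ℂ (Option (Fin n) → ℂ) := LinearMap.proj none

/-- The linear factors of `z ∏_{i<j} (x_i - x_j)(x_i - x_j - z)(x_i - x_j + z)`. -/
def forms (n : ℕ) : Set (Module.Dual ℂ (Option (Fin n) → ℂ)) :=
  {z} ∪ {α | ∃ i j : Fin n, i < j ∧
    (α = x i - x j ∨ α = x i - x j - z ∨ α = x i - x j + z)}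

theorem forms_finite (n : ℕ) : (forms n).Finite := by
  refine (Set.finite_singleton _).union ?_
  refine Set.Finite.subset (Set.finite_iUnion fun i : Fin n => Set.finite_iUnion fun j : Fin n =>
    Set.toFinite {x i - x j, x i - x j - z, x i - x j + z}) ?_
  rintro α ⟨i, j, -, h⟩
  simp only [Set.mem_iUnion]
  exact ⟨i, j, h⟩

theorem ne_zero_of_mem_forms (n : ℕ) : ∀ α ∈ forms n, α ≠ 0 := by
  rintro α (rfl | ⟨i, j, hij, h⟩) h0
  · have := LinearMap.congr_fun h0 (Pi.single none 1)
    simp [z] at this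
  · have h1 := LinearMap.congr_fun h0 (Pi.single (some i) 1)
    rcases h with rfl | rfl | rfl <;> simp [x, z, hij.ne'] at h1

end CatalanArrangement

/-- The cone `Cat_n` over the Catalan arrangement of type `A`, in `ℂ^{n+1}`. -/
def catalanArrangement (n : ℕ) : HyperplaneArrangement (Option (Fin n)) :=
  HyperplaneArrangement.ofForms (CatalanArrangement.forms n)
    (CatalanArrangement.forms_finite n) (CatalanArrangement.ne_zero_of_mem_forms n)

/-! By Saito's criterion it suffices to exhibit homogeneous logarithmic derivations whose
coefficient determinant is nonzero and whose degrees sum to the number of hyperplanes. Besides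
`translation` and `euler`, take `∑ F_k(x_i) ∂_{x_i}` for `0 ≤ k < n - 1`, where `F_k(t + z) - F_k(t)
= z t^k ∏ (t - x_i)`. The right side vanishes at `t = x_i`, so `F_k(x_i + z) = F_k(x_i)`. As `a - b`
divides `F_k(a) - F_k(b)`, each of `x_i - x_j` and `x_i - x_j ± z` divides `F_k(x_i) - F_k(x_j)`
(`primitiveDerivation_mem`). At the point `x_i = 2i`, `z = 1`, independence reduces to a Vandermonde
system with odd nodes (`eq_zero_of_sum_eval_basisFamily`). -/

namespace CatalanArrangement

/-! ### Discrete primitives of polynomials. -/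

section DiscreteIntegral

variable {R R' : Type*} [CommRing R] [Algebra ℂ R] [CommRing R'] [Algebra ℂ R']

/-- A homogenized Bernoulli-type polynomial `G_m(t, z)`: the discrete primitive of `t ^ m` for the
difference operator of step `z`, see `powPrimitive_add`. -/
noncomputable def powPrimitive (z : R) : ℕ → R → R
  | m, t => ((m + 1 : ℂ)⁻¹) • (t ^ (m + 1) -
      ∑ j : Fin m, ((m + 1).choose j : R) * z ^ (m - j) * powPrimitive z j t)

/-- In the binomial expansion of `(t + z)^(m+1) - t^(m+1)`, the recursion cancels, by induction,
every term except `(m + 1) z t^m`. -/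
theorem powPrimitive_add (z t : R) (m : ℕ) :
    powPrimitive z m (t + z) - powPrimitive z m t = z * t ^ m := by
  induction m using Nat.strong_induction_on with
  | _ m ih =>
    rw [powPrimitive, powPrimitive, ← smul_sub]
    have h1 : (t + z) ^ (m + 1) = t ^ (m + 1) + (m + 1 : R) * (z * t ^ m) +
        ∑ j : Fin m, ((m + 1).choose j : R) * z ^ (m - j) * (z * t ^ (j : ℕ)) := by
      rw [add_pow, Finset.sum_range_succ, Finset.sum_range_succ, Finset.sum_range]
      have : ∀ j : Fin m, t ^ (j : ℕ) * z ^ (m + 1 - j) * ((m + 1).choose j : R) =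
          ((m + 1).choose j : R) * z ^ (m - j) * (z * t ^ (j : ℕ)) := by
        intro j
        rw [Nat.sub_add_comm j.2.le, pow_succ]
        ring
      simp_rw [this]
      simp only [Nat.choose_self, Nat.choose_succ_self_right, Nat.sub_self, Nat.add_sub_cancel_left]
      push_cast
      ring
    have h2 : ∑ j : Fin m, ((m + 1).choose j : R) * z ^ (m - j) * (z * t ^ (j : ℕ)) =
        ∑ j : Fin m, ((m + 1).choose j : R) * z ^ (m - j) * powPrimitive z j (t + z) -
        ∑ j : Fin m, ((m + 1).choose j : R) * z ^ (m - j) * powPrimitive z j t := by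
      rw [← Finset.sum_sub_distrib]
      refine Finset.sum_congr rfl fun j _ => ?_
      rw [← ih j j.2]
      ring
    have h3 : (t + z) ^ (m + 1) -
        ∑ j : Fin m, ((m + 1).choose j : R) * z ^ (m - j) * powPrimitive z j (t + z) -
        (t ^ (m + 1) - ∑ j : Fin m, ((m + 1).choose j : R) * z ^ (m - j) * powPrimitive z j t)
        = (m + 1 : ℂ) • (z * t ^ m) := by
      rw [h1, h2, Algebra.smul_def]
      simp only [map_add, map_natCast, map_one]
      ring
    rw [h3, smul_smul, inv_mul_cancel₀ (by exact_mod_cast m.succ_ne_zero), one_smul]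

theorem sub_dvd_powPrimitive_sub (z a b : R) (m : ℕ) :
    a - b ∣ powPrimitive z m a - powPrimitive z m b := by
  induction m using Nat.strong_induction_on with
  | _ m ih =>
    rw [powPrimitive, powPrimitive, ← smul_sub, Algebra.smul_def, sub_sub_sub_comm,
      ← Finset.sum_sub_distrib]
    refine Dvd.dvd.mul_left (dvd_sub (sub_dvd_pow_sub_pow a b _) (Finset.dvd_sum fun j _ => ?_)) _
    rw [← mul_sub]
    exact (ih j j.2).mul_left _

theorem map_powPrimitive (f : R →ₐ[ℂ] R') (z t : R) (m : ℕ) :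
    f (powPrimitive z m t) = powPrimitive (f z) m (f t) := by
  induction m using Nat.strong_induction_on with
  | _ m ih =>
    rw [powPrimitive, powPrimitive, map_smul, map_sub, map_pow, map_sum]
    simp only [map_mul, map_natCast, map_pow, ih _ (Fin.is_lt _)]

theorem isHomogeneous_powPrimitive {σ : Type*} {z t : MvPolynomial σ ℂ} (hz : z.IsHomogeneous 1)
    (ht : t.IsHomogeneous 1) (m : ℕ) : (powPrimitive z m t).IsHomogeneous (m + 1) := by
  induction m using Nat.strong_induction_on with
  | _ m ih =>
    rw [powPrimitive, MvPolynomial.smul_eq_C_mul]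
    refine MvPolynomial.IsHomogeneous.C_mul (.sub (by simpa using ht.pow (m + 1))
      (.sum _ _ _ fun j _ => ?_)) _
    rw [← map_natCast (MvPolynomial.C (σ := σ) (R := ℂ)), mul_assoc]
    refine MvPolynomial.IsHomogeneous.C_mul ?_ _
    have h := (hz.pow (m - j)).mul (ih j j.2)
    rwa [show 1 * (m - j) + (j + 1) = m + 1 by omega] at h

variable {ι : Type*} [Fintype ι] [DecidableEq ι]

/-- The discrete primitive of `t ^ k * ∏ i, (t - x i)` for the difference operator of step `z`,
see `discretePrimitive_add`. -/
noncomputable def discretePrimitive (x : ι → R) (z : R) (k : ℕ) (t : R) : R :=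
  ∑ s : Finset ι, (∏ i ∈ sᶜ, -x i) * powPrimitive z (k + s.card) t

/-- Expand `∏ (t - x i)` over subsets and integrate monomial by monomial. -/
theorem discretePrimitive_add (x : ι → R) (z : R) (k : ℕ) (t : R) :
    discretePrimitive x z k (t + z) =
      discretePrimitive x z k t + z * (t ^ k * ∏ i, (t - x i)) := by
  rw [← sub_eq_iff_eq_add', discretePrimitive, discretePrimitive, ← Finset.sum_sub_distrib]
  simp_rw [← mul_sub, powPrimitive_add, sub_eq_add_neg, Fintype.prod_add, Finset.mul_sum,
    Finset.prod_const, pow_add]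
  exact Finset.sum_congr rfl fun s _ => by ring

theorem discretePrimitive_root_add (x : ι → R) (z : R) (k : ℕ) (i : ι) :
    discretePrimitive x z k (x i + z) = discretePrimitive x z k (x i) := by
  rw [discretePrimitive_add, Finset.prod_eq_zero (Finset.mem_univ i) (sub_self _)]
  ring

theorem sub_dvd_discretePrimitive_sub (x : ι → R) (z : R) (k : ℕ) (a b : R) :
    a - b ∣ discretePrimitive x z k a - discretePrimitive x z k b := by
  rw [discretePrimitive, discretePrimitive, ← Finset.sum_sub_distrib]
  refine Finset.dvd_sum fun s _ => ?_
  rw [← mul_sub]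
  exact (sub_dvd_powPrimitive_sub _ _ _ _).mul_left _

theorem map_discretePrimitive (f : R →ₐ[ℂ] R') (x : ι → R) (z : R) (k : ℕ) (t : R) :
    f (discretePrimitive x z k t) = discretePrimitive (fun i => f (x i)) (f z) k (f t) := by
  simp only [discretePrimitive, map_sum, map_mul, map_prod, map_neg, map_powPrimitive]

theorem isHomogeneous_discretePrimitive {σ : Type*} {x : ι → MvPolynomial σ ℂ}
    {z t : MvPolynomial σ ℂ} (hx : ∀ i, (x i).IsHomogeneous 1) (hz : z.IsHomogeneous 1)
    (ht : t.IsHomogeneous 1) (k : ℕ) :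
    (discretePrimitive x z k t).IsHomogeneous (Fintype.card ι + k + 1) := by
  refine .sum _ _ _ fun s _ => ?_
  have h := (MvPolynomial.IsHomogeneous.prod sᶜ _ _ fun i _ => (hx i).neg).mul
    (isHomogeneous_powPrimitive hz ht (k + s.card))
  have hs := s.card_le_univ
  rwa [Finset.sum_const, smul_eq_mul, mul_one, Finset.card_compl,
    show Fintype.card ι - s.card + (k + s.card + 1) = Fintype.card ι + k + 1 by omega] at h

end DiscreteIntegral

end CatalanArrangement

/-! ### A determinantal criterion for bases. -/

/-- Elements whose coordinate vectors have a nonzero determinant form a basis, if replacing any of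
them by any other element yields a multiple of that determinant. -/
theorem exists_basis_of_det_dvd_det {R M ι : Type*} [CommRing R] [IsDomain R] [AddCommGroup M]
    [Module R M] [Fintype ι] [DecidableEq ι] (f : M →ₗ[R] ι → R) (hf : Function.Injective f)
    (v : ι → M) (hdet : (Matrix.of fun i => f (v i)).det ≠ 0)
    (hdvd : ∀ m i, (Matrix.of fun i => f (v i)).det ∣
      (Matrix.of fun j => f (Function.update v i m j)).det) :
    ∃ b : Module.Basis ι R M, ∀ i, b i = v i := by
  have hli : LinearIndependent R v :=
    LinearIndependent.of_comp f (Matrix.linearIndependent_rows_of_det_ne_zero hdet)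
  refine ⟨Module.Basis.mk hli ?_, fun i => by rw [Module.Basis.mk_apply]⟩
  rintro m -
  rw [Submodule.mem_span_range_iff_exists_fun]
  -- The quotients `g` are the coefficients of `m` given by Cramer's rule.
  choose g hg using hdvd m
  refine ⟨g, hf (funext fun j => mul_left_cancel₀ hdet ?_)⟩
  have h1 := congrFun (Matrix.mulVec_cramer (Matrix.of fun i => f (v i)).transpose (f m)) j
  have hcr : ∀ i, (Matrix.of fun i => f (v i)).transpose.cramer (f m) i =
      (Matrix.of fun i => f (v i)).det * g i := by
    intro i
    rw [Matrix.cramer_apply, Matrix.updateCol_transpose, Matrix.det_transpose, ← hg i]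
    congr 1
    ext1 a b
    by_cases h : a = i
    · subst h
      simp
    · simp [h]
  rw [Matrix.det_transpose, Pi.smul_apply, smul_eq_mul] at h1
  rw [← h1, map_sum, Finset.sum_apply, Finset.mul_sum]
  refine Finset.sum_congr rfl fun i _ => ?_
  rw [hcr, map_smul, Pi.smul_apply, smul_eq_mul]
  simp only [Matrix.transpose_apply, Matrix.of_apply]
  ring

/-! ### Linear forms as polynomials. -/

namespace HyperplaneArrangement

open MvPolynomial

variable {σ : Type*} [Fintype σ] [DecidableEq σ]

theorem isHomogeneous_formPoly (α : Module.Dual ℂ (σ → ℂ)) : (formPoly α).IsHomogeneous 1 :=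
  .sum _ _ _ fun i _ => isHomogeneous_C_mul_X _ i

theorem eval_formPoly (α : Module.Dual ℂ (σ → ℂ)) (v : σ → ℂ) : eval v (formPoly α) = α v := by
  conv_rhs => rw [pi_eq_sum_univ' v]
  simp [formPoly, mul_comm]

theorem formPoly_smul (c : ℂ) (α : Module.Dual ℂ (σ → ℂ)) :
    formPoly (c • α) = C c * formPoly α := by
  simp [formPoly, Finset.mul_sum, mul_assoc]

theorem formPoly_add (α β : Module.Dual ℂ (σ → ℂ)) :
    formPoly (α + β) = formPoly α + formPoly β := by
  simp [formPoly, add_mul, Finset.sum_add_distrib]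

theorem formPoly_sub (α β : Module.Dual ℂ (σ → ℂ)) :
    formPoly (α - β) = formPoly α - formPoly β := by
  simp [formPoly, sub_mul, Finset.sum_sub_distrib]

theorem formPoly_proj (i : σ) :
    formPoly (LinearMap.proj i : Module.Dual ℂ (σ → ℂ)) = X i := by
  rw [formPoly, Finset.sum_eq_single i]
  · simp
  · intro j _ h
    simp [h.symm]
  · simp

theorem formPoly_ne_zero {α : Module.Dual ℂ (σ → ℂ)} (h : α ≠ 0) : formPoly α ≠ 0 := by
  intro h0
  refine h (LinearMap.ext fun v => ?_)
  rw [← eval_formPoly, h0, map_zero, LinearMap.zero_apply]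

theorem irreducible_formPoly {α : Module.Dual ℂ (σ → ℂ)} (h : α ≠ 0) :
    Irreducible (formPoly α) := by
  refine irreducible_of_totalDegree_eq_one
    ((isHomogeneous_formPoly α).totalDegree (formPoly_ne_zero h)) fun c hc => ?_
  rw [isUnit_iff_ne_zero]
  rintro rfl
  exact formPoly_ne_zero h (MvPolynomial.ext _ _ fun i => by simpa using hc i)

theorem ker_le_ker_of_formPoly_dvd {α β : Module.Dual ℂ (σ → ℂ)} (h : formPoly α ∣ formPoly β) :
    LinearMap.ker α ≤ LinearMap.ker β := by
  intro v hv
  obtain ⟨g, hg⟩ := h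
  rw [LinearMap.mem_ker] at hv ⊢
  rw [← eval_formPoly, hg, map_mul, eval_formPoly, hv, zero_mul]

/-- Divisibility would give an inclusion of kernels, which is an equality since both are maximal. -/
theorem isRelPrime_formPoly {α β : Module.Dual ℂ (σ → ℂ)} (hα : α ≠ 0) (hβ : β ≠ 0)
    (h : LinearMap.ker α ≠ LinearMap.ker β) : IsRelPrime (formPoly α) (formPoly β) := by
  rw [(irreducible_formPoly hα).isRelPrime_iff_not_dvd]
  intro hd
  have hc := LinearMap.isCoatom_ker_of_surjective (LinearMap.surjective hα)
  have hc' := LinearMap.isCoatom_ker_of_surjective (LinearMap.surjective hβ)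
  exact h ((hc.le_iff_eq hc'.1).1 (ker_le_ker_of_formPoly_dvd hd)).symm

theorem apply_formPoly (δ : Derivation ℂ (MvPolynomial σ ℂ) (MvPolynomial σ ℂ))
    (α : Module.Dual ℂ (σ → ℂ)) :
    δ (formPoly α) = ∑ i, C (α (Pi.single i 1)) * δ (X i) := by
  simp [formPoly, Derivation.leibniz, ← algebraMap_eq]

theorem exists_smul_of_ker_eq {V : Type*} [AddCommGroup V] [Module ℂ V] {α β : Module.Dual ℂ V}
    (h : LinearMap.ker α = LinearMap.ker β) : ∃ c : ℂ, β = c • α := by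
  have := mem_span_of_iInf_ker_le_ker (L := fun _ : Unit => α) (K := β) (by simp [h])
  rw [Set.range_const, Submodule.mem_span_singleton] at this
  obtain ⟨c, hc⟩ := this
  exact ⟨c, hc.symm⟩

/-- Membership in `D(A)` for an arrangement given by linear forms. -/
theorem mem_logDerivations_ofForms_iff {Φ : Set (Module.Dual ℂ (σ → ℂ))} {hfin : Φ.Finite}
    {hne : ∀ α ∈ Φ, α ≠ 0} {δ : Derivation ℂ (MvPolynomial σ ℂ) (MvPolynomial σ ℂ)} :
    δ ∈ (ofForms Φ hfin hne).logDerivations (fun _ => 1) ↔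
      ∀ α ∈ Φ, formPoly α ∣ δ (formPoly α) := by
  constructor
  · intro h α hα
    have := h ⟨LinearMap.ker α, α, hα, rfl⟩ α rfl
    rwa [pow_one, Ideal.mem_span_singleton] at this
  · rintro h ⟨_, α, hα, rfl⟩ β hβ
    obtain ⟨c, rfl⟩ := exists_smul_of_ker_eq hβ.symm
    rw [pow_one, Ideal.mem_span_singleton, formPoly_smul, Derivation.leibniz, ← algebraMap_eq,
      Derivation.map_algebraMap, smul_zero, add_zero, smul_eq_mul]
    exact mul_dvd_mul_left _ (h α hα)

/-! ### Saito's criterion. -/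

section Saito

variable {ι : Type*} [Fintype ι] [DecidableEq ι]

/-- The coefficient matrix of a family of derivations. -/
noncomputable def coeffMatrix (e : ι ≃ σ)
    (θ : ι → Derivation ℂ (MvPolynomial σ ℂ) (MvPolynomial σ ℂ)) :
    Matrix ι ι (MvPolynomial σ ℂ) :=
  Matrix.of fun i j => θ i (X (e j))

/-- The coefficient matrix sends the coefficient vector `w` of `α` to the vector of all `θ i
(formPoly α)`. Multiplying by the adjugate shows that `det • w` is divisible by `α`, and some entry
of `w` is a nonzero constant. -/
theorem formPoly_dvd_det_coeffMatrix (e : ι ≃ σ)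
    {θ : ι → Derivation ℂ (MvPolynomial σ ℂ) (MvPolynomial σ ℂ)}
    {α : Module.Dual ℂ (σ → ℂ)} (hα : α ≠ 0) (h : ∀ i, formPoly α ∣ θ i (formPoly α)) :
    formPoly α ∣ (coeffMatrix e θ).det := by
  obtain ⟨s, hs⟩ : ∃ s, α (Pi.single s 1) ≠ 0 := by
    by_contra! h0
    exact formPoly_ne_zero hα (by simp [formPoly, h0])
  set w : ι → MvPolynomial σ ℂ := fun j => C (α (Pi.single (e j) 1))
  have hw : (coeffMatrix e θ).mulVec w = fun i => θ i (formPoly α) := by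
    funext i
    rw [apply_formPoly, ← e.sum_comp]
    exact Finset.sum_congr rfl fun j _ => mul_comm _ _
  have h1 : (coeffMatrix e θ).det • w =
      (coeffMatrix e θ).adjugate.mulVec (fun i => θ i (formPoly α)) := by
    rw [← hw, Matrix.mulVec_mulVec, Matrix.adjugate_mul, Matrix.smul_mulVec, Matrix.one_mulVec]
  have h2 : formPoly α ∣ (coeffMatrix e θ).det * C (α (Pi.single s 1)) := by
    have h3 := congrFun h1 (e.symm s)
    simp only [Pi.smul_apply, smul_eq_mul, w, Equiv.apply_symm_apply] at h3
    rw [h3]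
    exact Finset.dvd_sum fun i _ => (h i).mul_left _
  exact ((isUnit_iff_ne_zero.2 hs).map C).dvd_mul_right.1 h2

omit [Fintype σ] [DecidableEq σ] in
theorem isHomogeneous_det_coeffMatrix (e : ι ≃ σ)
    {θ : ι → Derivation ℂ (MvPolynomial σ ℂ) (MvPolynomial σ ℂ)} {d : ι → ℕ}
    (h : ∀ i, IsHomogeneousDerivation (θ i) (d i)) :
    (coeffMatrix e θ).det.IsHomogeneous (∑ i, d i) := by
  rw [Matrix.det_apply]
  refine .sum _ _ _ fun p _ => ?_
  rw [← Equiv.sum_comp p]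
  have h1 : (∏ i, coeffMatrix e θ (p i) i).IsHomogeneous (∑ i, d (p i)) :=
    .prod _ _ _ fun i _ => h (p i) (e i)
  rcases Int.units_eq_one_or (Equiv.Perm.sign p) with hp | hp <;> rw [hp]
  · simpa using h1
  · simpa using h1.neg

omit [Fintype σ] [DecidableEq σ] in
theorem exists_basis_of_det_coeffMatrix_dvd (e : ι ≃ σ)
    {D : Submodule (MvPolynomial σ ℂ) (Derivation ℂ (MvPolynomial σ ℂ) (MvPolynomial σ ℂ))}
    {δ : ι → Derivation ℂ (MvPolynomial σ ℂ) (MvPolynomial σ ℂ)} (hδ : ∀ i, δ i ∈ D)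
    (hdet : (coeffMatrix e δ).det ≠ 0)
    (hdvd : ∀ θ : ι → Derivation ℂ (MvPolynomial σ ℂ) (MvPolynomial σ ℂ), (∀ i, θ i ∈ D) →
      (coeffMatrix e δ).det ∣ (coeffMatrix e θ).det) :
    ∃ b : Module.Basis ι (MvPolynomial σ ℂ) D,
      ∀ i, (b i : Derivation ℂ (MvPolynomial σ ℂ) (MvPolynomial σ ℂ)) = δ i := by
  let f : D →ₗ[MvPolynomial σ ℂ] (ι → MvPolynomial σ ℂ) :=
    { toFun := fun θ j => θ.1 (X (e j))
      map_add' := fun _ _ => rfl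
      map_smul' := fun _ _ => rfl }
  have hf : Function.Injective f := by
    intro θ η h
    refine Subtype.ext (derivation_ext fun s => ?_)
    simpa [f] using congrFun h (e.symm s)
  have key := exists_basis_of_det_dvd_det (R := MvPolynomial σ ℂ) (M := D) f hf
    (fun i => (⟨δ i, hδ i⟩ : D))
  obtain ⟨b, hb⟩ := key hdet fun θ i => hdvd _ fun j => Subtype.prop _
  exact ⟨b, fun i => by rw [hb]⟩

/-- **Saito's criterion**: homogeneous logarithmic derivations with nonvanishing coefficient
determinant, whose degrees add up to the number of hyperplanes, form a basis of `D(A)`. -/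
theorem exists_basis_logDerivations {Φ : Set (Module.Dual ℂ (σ → ℂ))} {hfin : Φ.Finite}
    {hne : ∀ α ∈ Φ, α ≠ 0} {κ : Type*} [Fintype κ] {α : κ → Module.Dual ℂ (σ → ℂ)}
    (hα : ∀ k, α k ∈ Φ) (hinj : Function.Injective fun k => LinearMap.ker (α k)) (e : ι ≃ σ)
    {δ : ι → Derivation ℂ (MvPolynomial σ ℂ) (MvPolynomial σ ℂ)} {d : ι → ℕ}
    (hδ : ∀ i, δ i ∈ (ofForms Φ hfin hne).logDerivations (fun _ => 1))
    (hhom : ∀ i, IsHomogeneousDerivation (δ i) (d i)) (hd : ∑ i, d i = Fintype.card κ)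
    (hdet : (coeffMatrix e δ).det ≠ 0) :
    ∃ b : Module.Basis ι (MvPolynomial σ ℂ) ((ofForms Φ hfin hne).logDerivations (fun _ => 1)),
      ∀ i, (b i : Derivation ℂ (MvPolynomial σ ℂ) (MvPolynomial σ ℂ)) = δ i := by
  set Q : MvPolynomial σ ℂ := ∏ k, formPoly (α k)
  have hQ0 : Q ≠ 0 := Finset.prod_ne_zero_iff.2 fun k _ => formPoly_ne_zero (hne _ (hα k))
  have hQhom : Q.IsHomogeneous (Fintype.card κ) := by
    have := IsHomogeneous.prod Finset.univ (fun k => formPoly (α k)) _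
      fun k _ => isHomogeneous_formPoly (α k)
    simpa using this
  have hdvd : ∀ θ : ι → Derivation ℂ (MvPolynomial σ ℂ) (MvPolynomial σ ℂ),
      (∀ i, θ i ∈ (ofForms Φ hfin hne).logDerivations (fun _ => 1)) →
      Q ∣ (coeffMatrix e θ).det := by
    intro θ hθ
    refine Finset.prod_dvd_of_isRelPrime (fun k _ l _ hkl => ?_) fun k _ => ?_
    · exact isRelPrime_formPoly (hne _ (hα k)) (hne _ (hα l)) fun h => hkl (hinj h)
    · exact formPoly_dvd_det_coeffMatrix e (hne _ (hα k)) fun i =>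
        mem_logDerivations_ofForms_iff.1 (hθ i) _ (hα k)
  -- Both `Q` and the determinant have degree `Fintype.card κ`, so their quotient is a constant.
  obtain ⟨c, hc⟩ : ∃ c : ℂ, (coeffMatrix e δ).det = Q * C c := by
    obtain ⟨g, hg⟩ := hdvd δ hδ
    have hg0 : g ≠ 0 := by
      rintro rfl
      exact hdet (by rw [hg, mul_zero])
    have h1 := (isHomogeneous_det_coeffMatrix e hhom).totalDegree hdet
    rw [hg, totalDegree_mul_of_isDomain hQ0 hg0, hQhom.totalDegree hQ0, hd] at h1
    have h2 := totalDegree_eq_zero_iff_eq_C.1 (show g.totalDegree = 0 by omega)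
    exact ⟨_, by rw [hg, ← h2]⟩
  have hc0 : c ≠ 0 := by
    rintro rfl
    exact hdet (by rw [hc, map_zero, mul_zero])
  refine exists_basis_of_det_coeffMatrix_dvd e hδ hdet fun θ hθ => ?_
  rw [hc]
  exact ((isUnit_iff_ne_zero.2 hc0).map C).mul_right_dvd.2 (hdvd θ hθ)

end Saito

end HyperplaneArrangement

/-! ### The hyperplanes of the Catalan arrangement, without repetition. -/

namespace CatalanArrangement

open MvPolynomial HyperplaneArrangement

variable {n : ℕ}

/-- The linear forms of the Catalan arrangement, each hyperplane listed once: `z`, and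
`x_i - x_j + ε z` for `i < j` and `ε ∈ {0, -1, 1}`. -/
noncomputable def indexedForm : Option (Σ j : Fin n, Fin j × Fin 3) →
    Module.Dual ℂ (Option (Fin n) → ℂ)
  | none => z
  | some ⟨j, i, c⟩ => x (i.castLE j.2.le) - x j + (![0, -1, 1] c : ℂ) • z

theorem indexedForm_mem (k : Option (Σ j : Fin n, Fin j × Fin 3)) : indexedForm k ∈ forms n := by
  rcases k with _ | ⟨j, i, c⟩
  · exact Or.inl rfl
  · refine Or.inr ⟨i.castLE j.2.le, j, i.2, ?_⟩
    fin_cases c <;> simp [indexedForm, sub_eq_add_neg]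

theorem card_indexedForm :
    Fintype.card (Option (Σ j : Fin n, Fin j × Fin 3)) = 1 + ∑ j ∈ Finset.range n, 3 * j := by
  rw [Fintype.card_option, Fintype.card_sigma, add_comm, Finset.sum_range]
  simp [mul_comm]

theorem ker_indexedForm_injective :
    Function.Injective fun k : Option (Σ j : Fin n, Fin j × Fin 3) =>
      LinearMap.ker (indexedForm k) := by
  have hs : ∀ (j : Fin n) (i : Fin j) (c : Fin 3) (s : Fin n),
      indexedForm (some ⟨j, i, c⟩) (Pi.single (some s) 1) =
        (if i.castLE j.2.le = s then 1 else 0) - (if j = s then 1 else 0) := by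
    intro j i c s
    simp [indexedForm, x, z, Pi.single_apply]
  have hz : ∀ (j : Fin n) (i : Fin j) (c : Fin 3),
      indexedForm (some ⟨j, i, c⟩) (Pi.single none 1) = (![0, -1, 1] c : ℂ) := by
    intro j i c
    simp [indexedForm, x, z]
  intro k l hkl
  obtain ⟨a, ha⟩ := exists_smul_of_ker_eq hkl
  have hx := fun i => LinearMap.congr_fun ha (Pi.single (some i) 1)
  have hn := LinearMap.congr_fun ha (Pi.single none 1)
  simp only [LinearMap.smul_apply, smul_eq_mul] at hx hn
  rcases k with _ | ⟨j, i, c⟩ <;> rcases l with _ | ⟨j', i', c'⟩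
  · rfl
  · have hi : i'.castLE j'.2.le ≠ j' := Fin.ne_of_lt i'.2
    have h := hx j'
    rw [hs, if_neg hi] at h
    simp [indexedForm, z] at h
  · have hi : i.castLE j.2.le ≠ j := Fin.ne_of_lt i.2
    have h := hx j
    rw [hs, if_neg hi] at h
    have ha0 : a = 0 := by simpa [indexedForm, z] using h
    simp [ha0, indexedForm, z] at hn
  · have hlt : i.castLE j.2.le < j := i.2
    have hlt' : i'.castLE j'.2.le < j' := i'.2
    simp only [hs] at hx
    by_cases hj : j = j'
    · subst hj
      -- The coefficient `-1` at `x_j` in both forms forces the ratio `a = 1`.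
      have h1 := hx j
      rw [if_neg hlt.ne, if_neg hlt'.ne, if_pos rfl] at h1
      obtain rfl : a = 1 := by linear_combination h1
      have h2 := hx (i.castLE j.2.le)
      rw [if_pos rfl, if_neg hlt.ne'] at h2
      have hi : i = i' := by
        by_contra hne
        rw [if_neg fun h => hne (Fin.castLE_injective _ h).symm] at h2
        norm_num at h2
      subst hi
      rw [hz, hz, one_mul] at hn
      have hc : c = c' := by
        fin_cases c <;> fin_cases c' <;> first | rfl | (exfalso; norm_num at hn)
      rw [hc]
    · exfalso
      have h1 := hx j
      have h3 := hx j'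
      rw [if_neg hlt.ne, if_neg (Ne.symm hj), if_pos rfl] at h1
      rw [if_neg hlt'.ne, if_neg hj, if_pos rfl] at h3
      -- For `j ≠ j'` proportionality would need the two pairs to be swapped, against `i < j` and
      -- `i' < j'`.
      by_cases hp : i.castLE j.2.le = j'
      · rw [if_pos hp] at h3
        by_cases hq : i'.castLE j'.2.le = j
        · exact lt_asymm (hp ▸ hlt) (hq ▸ hlt')
        · rw [if_neg hq] at h1
          have : (1 : ℂ) = 0 := by linear_combination -h1 - h3
          exact one_ne_zero this
      · rw [if_neg hp] at h3
        norm_num at h3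

/-! ### The basis derivations and their degrees. -/

/-- The derivation `∑ F_k(x_i) ∂_{x_i}`, with `F_k` the discrete primitive of
`t ^ k * ∏ i, (t - x_i)` for step `z`. -/
noncomputable def primitiveDerivation (n k : ℕ) :
    Derivation ℂ (MvPolynomial (Option (Fin n)) ℂ) (MvPolynomial (Option (Fin n)) ℂ) :=
  mkDerivation ℂ fun s => s.elim 0 fun i =>
    discretePrimitive (fun j : Fin n => X (some j)) (X none) k (X (some i))

/-- The derivation `∑ ∂_{x_i}`. -/
noncomputable def translation (n : ℕ) :
    Derivation ℂ (MvPolynomial (Option (Fin n)) ℂ) (MvPolynomial (Option (Fin n)) ℂ) :=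
  mkDerivation ℂ fun s => s.elim 0 fun _ => 1

/-- The Euler derivation. -/
noncomputable def euler (n : ℕ) :
    Derivation ℂ (MvPolynomial (Option (Fin n)) ℂ) (MvPolynomial (Option (Fin n)) ℂ) :=
  mkDerivation ℂ X

theorem mem_logDerivations_iff
    {δ : Derivation ℂ (MvPolynomial (Option (Fin n)) ℂ) (MvPolynomial (Option (Fin n)) ℂ)} :
    δ ∈ (catalanArrangement n).logDerivations (fun _ => 1) ↔ X none ∣ δ (X none) ∧
      ∀ i j : Fin n, i < j → (X (some i) - X (some j) ∣ δ (X (some i)) - δ (X (some j))) ∧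
        (X (some i) - X (some j) - X none ∣ δ (X (some i)) - δ (X (some j)) - δ (X none)) ∧
        (X (some i) - X (some j) + X none ∣ δ (X (some i)) - δ (X (some j)) + δ (X none)) := by
  have hx : ∀ i : Fin n, formPoly (x i) = X (some i) := fun i => formPoly_proj _
  have hz : formPoly (z : Module.Dual ℂ (Option (Fin n) → ℂ)) = X none := formPoly_proj _
  refine mem_logDerivations_ofForms_iff.trans ⟨fun h => ⟨?_, fun i j hij => ⟨?_, ?_, ?_⟩⟩, ?_⟩
  · simpa [hz] using h z (Or.inl rfl)
  · simpa [hx, formPoly_sub] using h (x i - x j) (Or.inr ⟨i, j, hij, Or.inl rfl⟩)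
  · simpa [hx, hz, formPoly_sub] using
      h (x i - x j - z) (Or.inr ⟨i, j, hij, Or.inr (Or.inl rfl)⟩)
  · simpa [hx, hz, formPoly_sub, formPoly_add] using
      h (x i - x j + z) (Or.inr ⟨i, j, hij, Or.inr (Or.inr rfl)⟩)
  · rintro ⟨h0, h⟩ α (rfl | ⟨i, j, hij, rfl | rfl | rfl⟩)
    · simpa [hz] using h0
    · simpa [hx, formPoly_sub] using (h i j hij).1
    · simpa [hx, hz, formPoly_sub] using (h i j hij).2.1
    · simpa [hx, hz, formPoly_sub, formPoly_add] using (h i j hij).2.2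

theorem translation_mem : translation n ∈ (catalanArrangement n).logDerivations (fun _ => 1) := by
  simp [mem_logDerivations_iff, translation, mkDerivation_X]

theorem euler_mem : euler n ∈ (catalanArrangement n).logDerivations (fun _ => 1) := by
  simp [mem_logDerivations_iff, euler, mkDerivation_X]

theorem primitiveDerivation_mem (k : ℕ) :
    primitiveDerivation n k ∈ (catalanArrangement n).logDerivations (fun _ => 1) := by
  rw [mem_logDerivations_iff]
  simp only [primitiveDerivation, mkDerivation_X, Option.elim_none, Option.elim_some, sub_zero,
    add_zero, dvd_zero, true_and]
  set F := discretePrimitive (fun j : Fin n => (X (some j) : MvPolynomial (Option (Fin n)) ℂ))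
    (X none) k
  have hroot : ∀ i : Fin n, F (X (some i) + X none) = F (X (some i)) := fun i =>
    discretePrimitive_root_add (fun j : Fin n => X (some j)) (X none) k i
  have hdvd : ∀ a b, a - b ∣ F a - F b := sub_dvd_discretePrimitive_sub _ _ _
  refine fun i j _ => ⟨hdvd _ _, ?_, ?_⟩
  -- Write `x_i - x_j - z` as `x_i - (x_j + z)`, and in the other case `x_i - x_j + z` as `(x_i + z)
  -- - x_j`.
  · rw [← hroot j, sub_sub]
    exact hdvd _ _
  · rw [← hroot i, sub_add_eq_add_sub]
    exact hdvd _ _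

/-- The basis of `D(Cat_{m+1})`: translation, Euler, and the derivations `primitiveDerivation`. -/
noncomputable def basisFamily (m : ℕ) : Fin (m + 2) →
    Derivation ℂ (MvPolynomial (Option (Fin (m + 1))) ℂ) (MvPolynomial (Option (Fin (m + 1))) ℂ) :=
  Fin.cons (translation _) (Fin.cons (euler _) fun k => primitiveDerivation _ k)

/-- The degrees of `basisFamily`. -/
def basisDegree (m : ℕ) : Fin (m + 2) → ℕ :=
  Fin.cons 0 (Fin.cons 1 fun k : Fin m => m + 2 + k)

theorem basisFamily_mem (m : ℕ) (i : Fin (m + 2)) :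
    basisFamily m i ∈ (catalanArrangement (m + 1)).logDerivations (fun _ => 1) := by
  refine Fin.cases translation_mem (fun i => ?_) i
  exact Fin.cases euler_mem (fun k => primitiveDerivation_mem _) i

theorem isHomogeneousDerivation_basisFamily (m : ℕ) (i : Fin (m + 2)) :
    IsHomogeneousDerivation (basisFamily m i) (basisDegree m i) := by
  refine Fin.cases (fun s => ?_) (fun i => Fin.cases (fun s => ?_) (fun k s => ?_) i) i
  · rcases s with _ | s
    · simpa [basisFamily, translation, mkDerivation_X] using isHomogeneous_zero _ _ _
    · simpa [basisFamily, translation, mkDerivation_X, basisDegree] using isHomogeneous_one _ _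
  · simpa [basisFamily, euler, mkDerivation_X, basisDegree] using isHomogeneous_X _ _
  · rcases s with _ | s
    · simpa [basisFamily, primitiveDerivation, mkDerivation_X] using isHomogeneous_zero _ _ _
    · have h := isHomogeneous_discretePrimitive
        (fun j : Fin (m + 1) => isHomogeneous_X ℂ (some j)) (isHomogeneous_X ℂ none)
        (isHomogeneous_X ℂ (some s)) k
      rw [Fintype.card_fin, show m + 1 + (k : ℕ) + 1 = m + 2 + k by omega] at h
      simpa [basisFamily, primitiveDerivation, mkDerivation_X, basisDegree] using h

theorem sum_basisDegree (m : ℕ) :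
    ∑ i, basisDegree m i = 1 + ∑ j ∈ Finset.range (m + 1), 3 * j := by
  rw [Fin.sum_univ_succ, Fin.sum_univ_succ]
  simp only [basisDegree, Fin.cons_zero, Fin.cons_succ, zero_add]
  rw [← Finset.sum_range (fun k => m + 2 + k), Finset.sum_add_distrib, ← Finset.mul_sum,
    Finset.sum_range_succ, Finset.sum_const, Finset.card_range, smul_eq_mul]
  have h := Finset.sum_range_id_mul_two (m + 1)
  rw [Finset.sum_range_succ, Nat.add_sub_cancel] at h
  nlinarith

/-! ### Nonvanishing of the determinant. -/

/-- The point `x_i = 2 i`, `z = 1`, at which the coefficient determinant does not vanish. -/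
def evenPoint (m : ℕ) (s : Option (Fin (m + 1))) : ℂ := s.elim 1 fun i => 2 * i

/-- The `z`-coordinate isolates the Euler coefficient. Differences of consecutive `x`-coordinates
remove the translation coefficient and leave a Vandermonde system for the others. -/
theorem eq_zero_of_sum_eval_basisFamily (m : ℕ) (v : Fin (m + 2) → ℂ)
    (h : ∀ s, ∑ i, v i * aeval (evenPoint m) (basisFamily m i (X s)) = 0) : v = 0 := by
  set F : ℕ → ℂ → ℂ := discretePrimitive (fun j : Fin (m + 1) => (2 * j : ℂ)) 1
  have hnone := h none
  have hsome := fun i => h (some i)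
  simp only [Fin.sum_univ_succ, basisFamily, Fin.cons_zero, Fin.cons_succ, translation, euler,
    primitiveDerivation, mkDerivation_X, Option.elim_none, Option.elim_some, map_zero, map_one,
    mul_zero, mul_one, aeval_X, Finset.sum_const_zero, zero_add, add_zero, map_discretePrimitive,
    evenPoint] at hnone hsome
  simp only [hnone, zero_mul, zero_add] at hsome
  -- Since `2i` is a root, `F k (2i) = F k (2i + 1)`, so only the step from `2i + 1` to `2i + 2`
  -- contributes.
  have hstep : ∀ (k : ℕ) (i : Fin m), F k (2 * (i + 1 : ℕ)) - F k (2 * i) =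
      (2 * i + 1) ^ k * ∏ j : Fin (m + 1), ((2 * i + 1 : ℂ) - 2 * j) := by
    intro k i
    have h1 := discretePrimitive_add (fun j : Fin (m + 1) => (2 * j : ℂ)) 1 k (2 * i + 1)
    have h2 := discretePrimitive_root_add (fun j : Fin (m + 1) => (2 * j : ℂ)) 1 k i.castSucc
    simp only [Fin.val_castSucc] at h2
    rw [h2, one_mul] at h1
    rw [sub_eq_iff_eq_add', ← h1]
    congr 1
    push_cast
    ring
  have hvan : ∀ i : Fin m, ∑ k : Fin m, (2 * i + 1 : ℂ) ^ (k : ℕ) * v k.succ.succ = 0 := by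
    intro i
    have h1 := congrArg₂ (· - ·) (hsome i.succ) (hsome i.castSucc)
    simp only [Fin.val_succ, Fin.val_castSucc, add_sub_add_left_eq_sub, sub_zero,
      ← Finset.sum_sub_distrib, ← mul_sub] at h1
    -- Spacing the roots by two keeps the odd nodes away from them, so this factor can be cancelled.
    have h2 : (∏ j : Fin (m + 1), ((2 * i + 1 : ℂ) - 2 * j)) ≠ 0 := by
      refine Finset.prod_ne_zero_iff.2 fun j _ hj => ?_
      have : (2 * (i : ℕ) + 1 : ℕ) = 2 * (j : ℕ) := by exact_mod_cast sub_eq_zero.1 hj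
      omega
    apply mul_left_cancel₀ h2
    rw [mul_zero, ← h1, Finset.mul_sum]
    refine Finset.sum_congr rfl fun k _ => ?_
    rw [show (discretePrimitive (fun j : Fin (m + 1) => (2 * j : ℂ)) 1) = F from rfl, hstep]
    ring
  have hv := Matrix.eq_zero_of_forall_index_sum_pow_mul_eq_zero
    (f := fun i : Fin m => (2 * i + 1 : ℂ)) (fun i j hij => by
      have hij' : (2 * i + 1 : ℂ) = 2 * j + 1 := hij
      have : (2 * (i : ℕ) + 1 : ℕ) = 2 * (j : ℕ) + 1 := by exact_mod_cast hij'
      exact Fin.ext (by omega)) hvan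
  have hv' : ∀ k : Fin m, v k.succ.succ = 0 := congrFun hv
  have h0 := hsome 0
  simp only [hv', zero_mul, Finset.sum_const_zero, add_zero] at h0
  funext i
  exact Fin.cases h0 (fun i => Fin.cases hnone hv' i) i

theorem det_coeffMatrix_basisFamily_ne_zero (m : ℕ) (e : Fin (m + 2) ≃ Option (Fin (m + 1))) :
    (coeffMatrix e (basisFamily m)).det ≠ 0 := by
  intro h
  have h1 := congrArg (aeval (evenPoint m)) h
  rw [map_zero, AlgHom.map_det] at h1
  obtain ⟨v, hv0, hv⟩ := Matrix.exists_vecMul_eq_zero_iff.2 h1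
  refine hv0 (eq_zero_of_sum_eval_basisFamily m v fun s => ?_)
  simpa [Matrix.vecMul, dotProduct, coeffMatrix] using congrFun hv (e.symm s)

theorem exists_basis (m : ℕ) :
    ∃ b : Module.Basis (Fin (m + 2)) (MvPolynomial (Option (Fin (m + 1))) ℂ)
      ((catalanArrangement (m + 1)).logDerivations (fun _ => 1)), ∀ i, (b i : Derivation ℂ
        (MvPolynomial (Option (Fin (m + 1))) ℂ) (MvPolynomial (Option (Fin (m + 1))) ℂ)) =
          basisFamily m i := by
  -- Any bijection serves: the determinant is nonzero for every ordering of the coordinates.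
  have e : Fin (m + 2) ≃ Option (Fin (m + 1)) := Fintype.equivOfCardEq (by simp)
  exact exists_basis_logDerivations indexedForm_mem ker_indexedForm_injective e
    (basisFamily_mem m) (isHomogeneousDerivation_basisFamily m)
    ((sum_basisDegree m).trans card_indexedForm.symm) (det_coeffMatrix_basisFamily_ne_zero m e)

end CatalanArrangement

theorem mainTheorem3 (n : ℕ) (hn : 1 ≤ n) :
    (catalanArrangement n).IsFreeWithExponents (0 :: 1 :: List.Ico (n + 1) (2 * n)) := by
  -- With `n = m + 1` there are exactly `m` primitive derivations, none when `n = 1`.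
  obtain ⟨m, rfl⟩ := Nat.exists_eq_add_of_le' hn
  have hlen : m + 2 = (0 :: 1 :: List.Ico (m + 1 + 1) (2 * (m + 1))).length := by
    simp only [List.length_cons, List.Ico.length]
    omega
  obtain ⟨b, hb⟩ := CatalanArrangement.exists_basis m
  refine ⟨b.reindex (finCongr hlen), fun i => ?_⟩
  obtain ⟨i, rfl⟩ := (finCongr hlen).surjective i
  have hdeg : (0 :: 1 :: List.Ico (m + 1 + 1) (2 * (m + 1))).get (finCongr hlen i) =
      CatalanArrangement.basisDegree m i := by
    refine Fin.cases rfl (fun i => Fin.cases rfl (fun k => ?_) i) i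
    have hk : (k : ℕ) < (List.Ico (m + 1 + 1) (2 * (m + 1))).length := by
      rw [List.Ico.length]
      omega
    change (List.Ico (m + 1 + 1) (2 * (m + 1)))[(k : ℕ)] = m + 2 + k
    simp [List.Ico]
  rw [hdeg, Module.Basis.reindex_apply, Equiv.symm_apply_apply, hb]
  exact CatalanArrangement.isHomogeneousDerivation_basisFamily m i
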